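/- Let $m\ge 3$ be an integer, let $D\subset\{0,1,\dots,m-1\}$ with $1<\#D<m$, and let \[ K_{m,D}=\Bigl\{\sum_{j\ge 1}\frac{d_j}{m^j} : d_j\in D\text{ for all }j\ge 1\Bigr\} \] be the associated missing-digit set. Put $c_{m,D}=2(m-1)\min\bigl\{1,\frac{\#D}{m-\#D}\bigr\}$. Write $\nu_p$ for the $p$-adic valuation, and let $P^+(n)$ be the largest prime divisor of $n$, with $P^+(1)=1$. Let $(a_n)_{n\ge1}$ be a sequence of positive integers, and let \[ Q_n=\frac{a_n}{(a_n,m^\infty)},\qquad (A,m^\infty)=\prod_{p\mid m}p^{\nu_p(A)}\quad(p\text{ prime}), \] be the part of $a_n$ coprime to $m$. Fix a prime $p_0\nmid m$, and put $t=\nu_{p_0}\bigl(m^{d}-1\bigr)$, where $d$ is the multiplicative order of $m$ modulo $p_0$, if $p_0$ is odd, and $t=\nu_2(m^2-1)-1$ if $p_0=2$. Suppose that $\alpha,\beta:\mathbb{N}\to\mathbb{R}$ are functions and $n_0\ge N\ge 1$ are integers such that for every $n\ge N$ \[ \nu_{p_0}(Q_n)\ge\alpha(n),\qquad P^+(Q_n)\le\beta(n),\qquad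 \beta(n)\ge 2, \] and for every $n\ge n_0$ \[ \alpha(n)>t+\log_{p_0}(\beta(n)-1)+\log_{p_0}(c_{m,D}). \] Then $\frac1{a_n}\notin K_{m,D}$ for every $n\ge n_0$. In particular, the intersection $\bigl\{\frac1{a_n}:n\ge 1\bigr\}\cap K_{m,D}$ is finite. -/

import Mathlib

noncomputable section

namespace MissingDigit

/-- The missing-digit set `K_{m,D}`: all real numbers `∑_{j ≥ 1} d_j / m ^ j` with every digit
`d_j` in `D`. The digit `d_j` (with `j ≥ 1`) is `d (j - 1)` here, so the sum runs over all `j : ℕ`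
with terms `d j / m ^ (j + 1)`. -/
def missingDigitSet (m : ℕ) (D : Finset ℕ) : Set ℝ :=
  {x | ∃ d : ℕ → ℕ, (∀ j, d j ∈ D) ∧ HasSum (fun j : ℕ => (d j : ℝ) / (m : ℝ) ^ (j + 1)) x}

/-- The full `m`-part `(A, m^∞) = ∏_{p ∣ m} p ^ ν_p(A)` of a positive integer `A`. -/
def mPart (A m : ℕ) : ℕ :=
  ∏ p ∈ m.primeFactors, p ^ padicValNat p A

/-- The `m`-coprime part `Q = A / (A, m^∞)` of `A`; the division is exact by `mPart_dvd`. -/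
def coprimePart (A m : ℕ) : ℕ :=
  A / mPart A m

theorem mPart_dvd (A m : ℕ) : mPart A m ∣ A := by
  unfold mPart
  refine Finset.prod_dvd_of_isRelPrime (fun p hp q hq hpq => ?_) fun p _ => pow_padicValNat_dvd
  exact Nat.coprime_iff_isRelPrime.mp (Nat.Coprime.pow _ _
    ((Nat.coprime_primes (Nat.prime_of_mem_primeFactors hp)
      (Nat.prime_of_mem_primeFactors hq)).mpr hpq))

/-- The largest prime divisor `P⁺(n)` of `n`, with `P⁺(1) = 1`. -/
def largestPrimeFactor (n : ℕ) : ℕ :=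
  if n = 1 then 1 else n.primeFactors.sup id

/-- The overhead parameter `t(m, p)`: it is `ν_p(m ^ d - 1)`, with `d` the multiplicative order of
`m` modulo `p`, if `p` is odd, and `ν_2(m ^ 2 - 1) - 1` if `p = 2`. -/
def overhead (m p : ℕ) : ℤ :=
  if p = 2 then (padicValNat 2 (m ^ 2 - 1) : ℤ) - 1
  else (padicValNat p (m ^ orderOf (m : ZMod p) - 1) : ℤ)

/-- The constant `c_{m,D} = 2 (m - 1) min {1, #D / (m - #D)}`. -/
def korobovConst (m : ℕ) (D : Finset ℕ) : ℝ :=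
  2 * ((m : ℝ) - 1) * min 1 ((D.card : ℝ) / ((m : ℝ) - (D.card : ℝ)))

end MissingDigit

end

namespace MissingDigit

/-! If `1 / a n` lies in `K_{m,D}`, then so do its tails, which are the fractions `(b * m ^ k % Q) /
Q`; their leading digits all lie in `D` (`digit_mem_of_mem`). Write `Q = p ^ ν * R` with `p ∤ R`. A
suitable power of `m` is `1` modulo `L = p ^ w * R` and has order `M = p ^ (ν - w)` modulo `Q`, so
the orbit fills a residue class modulo `L`. These `M` equally spaced points show at least `min m M`
leading digits (`exists_digit_notMem`), too many once `M > #D`. The logarithmic hypothesis yields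
exactly `p ^ w * #D < p ^ ν`. -/

/-! ### The part of `a` coprime to `m` -/

theorem mPart_dvd_pow (a m : ℕ) : mPart a m ∣ m ^ a := by
  unfold mPart
  refine Finset.prod_dvd_of_isRelPrime (fun p hp q hq hpq => ?_) fun p hp => ?_
  · exact Nat.coprime_iff_isRelPrime.mp (Nat.Coprime.pow _ _
      ((Nat.coprime_primes (Nat.prime_of_mem_primeFactors hp)
        (Nat.prime_of_mem_primeFactors hq)).mpr hpq))
  · refine (pow_dvd_pow p ?_).trans (pow_dvd_pow_of_dvd (Nat.dvd_of_mem_primeFactors hp) a)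
    exact (padicValNat_le_nat_log a).trans (Nat.log_le_self p a)

theorem coprime_coprimePart {a m : ℕ} (ha : a ≠ 0) (hm : m ≠ 0) :
    (coprimePart a m).Coprime m := by
  refine Nat.Coprime.symm (Nat.coprime_of_dvd fun p hp hpm hpQ => ?_)
  have : Fact p.Prime := ⟨hp⟩
  have h1 : p ^ padicValNat p a ∣ mPart a m :=
    Finset.dvd_prod_of_mem (fun p => p ^ padicValNat p a)
      (Nat.mem_primeFactors.mpr ⟨hp, hpm, hm⟩)
  have h2 : mPart a m * coprimePart a m = a := Nat.mul_div_cancel' (mPart_dvd a m)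
  apply pow_succ_padicValNat_not_dvd (p := p) ha
  rw [pow_succ]
  calc _ ∣ mPart a m * coprimePart a m := mul_dvd_mul h1 hpQ
    _ = a := h2

/-! ### Tails of base-`m` expansions -/

theorem hasSum_digits_mem_Icc {m : ℕ} (hm : 2 ≤ m) {d : ℕ → ℕ} (hd : ∀ j, d j < m) {x : ℝ}
    (hx : HasSum (fun j : ℕ => (d j : ℝ) / (m : ℝ) ^ (j + 1)) x) : 0 ≤ x ∧ x ≤ 1 := by
  have hm' : (2 : ℝ) ≤ m := by exact_mod_cast hm
  refine ⟨hx.nonneg fun j => by positivity, ?_⟩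
  have hg := (hasSum_geometric_of_lt_one (r := (m : ℝ)⁻¹) (by positivity)
    (inv_lt_one_of_one_lt₀ (by linarith))).mul_left (((m : ℝ) - 1) / m)
  have h1 : ((m : ℝ) - 1) / m * (1 - (m : ℝ)⁻¹)⁻¹ = 1 := by
    have : (m : ℝ) - 1 ≠ 0 := by linarith
    field_simp
  rw [h1] at hg
  refine hasSum_le (fun j => ?_) hx hg
  have h2 : (d j : ℝ) ≤ (m : ℝ) - 1 := by
    have : (d j : ℝ) + 1 ≤ m := by exact_mod_cast hd j
    linarith
  calc (d j : ℝ) / (m : ℝ) ^ (j + 1) ≤ ((m : ℝ) - 1) / (m : ℝ) ^ (j + 1) := by gcongr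
    _ = _ := by rw [inv_pow]; field_simp; ring

theorem hasSum_digits_shift {m : ℕ} (hm : m ≠ 0) {d : ℕ → ℕ} {x : ℝ}
    (hx : HasSum (fun j : ℕ => (d j : ℝ) / (m : ℝ) ^ (j + 1)) x) :
    HasSum (fun j : ℕ => (d (j + 1) : ℝ) / (m : ℝ) ^ (j + 1)) (m * x - d 0) := by
  have hm' : (m : ℝ) ≠ 0 := by exact_mod_cast hm
  have h := ((hasSum_nat_add_iff' 1).mpr hx).mul_left (m : ℝ)
  convert! h using 1
  · funext j
    field_simp
    ring
  · rw [Finset.sum_range_one]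
    field_simp
    ring

theorem exists_hasSum_digits_shift {m : ℕ} (hm : m ≠ 0) {d : ℕ → ℕ} {x : ℝ}
    (hx : HasSum (fun j : ℕ => (d j : ℝ) / (m : ℝ) ^ (j + 1)) x) (n : ℕ) :
    ∃ z : ℤ, HasSum (fun j : ℕ => (d (j + n) : ℝ) / (m : ℝ) ^ (j + 1)) (m ^ n * x - z) := by
  induction n with
  | zero => exact ⟨0, by simpa using hx⟩
  | succ n ih =>
    obtain ⟨z, hz⟩ := ih
    refine ⟨m * z + d n, ?_⟩
    convert hasSum_digits_shift (d := fun j => d (j + n)) hm hz using 1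
    · funext j
      rw [show j + (n + 1) = j + 1 + n by ring]
    · push_cast
      simp
      ring

/-- A number in `[0, 1]` congruent to `b / Q` modulo `1`, where `Q > 1` is coprime to `b`. -/
theorem eq_mod_div {b Q : ℕ} (hQ : 1 < Q) (hb : b.Coprime Q) {y : ℝ} {z : ℤ}
    (hy : y = b / Q - z) (h0 : 0 ≤ y) (h1 : y ≤ 1) : y = (b % Q : ℕ) / Q := by
  have hQ' : (0 : ℝ) < Q := by exact_mod_cast (by omega : 0 < Q)
  have e : y * Q = ((b : ℤ) - z * Q : ℤ) := by
    push_cast; rw [hy]; field_simp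
  have l0 : (0 : ℤ) ≤ (b : ℤ) - z * Q := by
    have : (0 : ℝ) ≤ ((b : ℤ) - z * Q : ℤ) := by rw [← e]; positivity
    exact_mod_cast this
  have l1 : (b : ℤ) - z * Q ≤ Q := by
    have : (((b : ℤ) - z * Q : ℤ) : ℝ) ≤ ((Q : ℤ) : ℝ) := by
      rw [← e]; push_cast; nlinarith
    exact_mod_cast this
  -- A tail with all digits `m - 1` equals `1`; coprimality with `Q > 1` excludes it.
  have l2 : (b : ℤ) - z * Q ≠ Q := by
    intro h
    have : (Q : ℤ) ∣ b := ⟨z + 1, by linarith⟩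
    have := Nat.eq_one_of_dvd_coprimes hb (Int.natCast_dvd_natCast.mp this) dvd_rfl
    omega
  have l3 : (((b % Q : ℕ) : ℤ)) = (b : ℤ) - z * Q := by
    push_cast
    rw [← Int.sub_mul_emod_self_right (b : ℤ) z Q]
    exact Int.emod_eq_of_lt l0 (lt_of_le_of_ne l1 l2)
  rw [eq_div_iff hQ'.ne', e, ← l3, Int.cast_natCast]

/-- The digits of `x ∈ K_{m,D}` whose tail after `s` digits is `b / Q` modulo `1`. -/
theorem digit_mem_of_mem {m : ℕ} (hm : 2 ≤ m) {D : Finset ℕ} (hD : ∀ d ∈ D, d < m) {x : ℝ}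
    (hx : x ∈ missingDigitSet m D) {b Q s : ℕ} (hQ : 1 < Q) (hQm : Q.Coprime m)
    (hb : b.Coprime Q) (hs : (m : ℝ) ^ s * x = b / Q) (k : ℕ) :
    m * (b * m ^ k % Q) / Q ∈ D := by
  obtain ⟨d, hdD, hd⟩ := hx
  have hQ' : (0 : ℝ) < Q := by exact_mod_cast (by omega : 0 < Q)
  have tail : ∀ k, HasSum (fun j : ℕ => (d (j + (s + k)) : ℝ) / (m : ℝ) ^ (j + 1))
      ((b * m ^ k % Q : ℕ) / Q) := by
    intro k
    obtain ⟨z, hz⟩ := exists_hasSum_digits_shift (by omega) hd (s + k)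
    obtain ⟨h0, h1⟩ := hasSum_digits_mem_Icc hm (fun j => hD _ (hdD _)) hz
    rw [← eq_mod_div (b := b * m ^ k) hQ (hb.mul_left (hQm.symm.pow_left k)) (z := z) ?_ h0 h1]
    · exact hz
    · rw [pow_add, mul_right_comm, hs]
      push_cast
      ring
  have h := hasSum_digits_shift (by omega : m ≠ 0) (tail k)
  have h' := tail (k + 1)
  have e := h.unique (by convert h' using 1; funext j; rw [show j + 1 + (s + k) = j + (s + (k + 1)) by ring])
  simp only [zero_add] at e
  -- One step of long division: the digit is the quotient, the next tail the remainder.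
  have e2 : m * (b * m ^ k % Q) = d (s + k) * Q + b * m ^ (k + 1) % Q := by
    have : (m : ℝ) * (b * m ^ k % Q : ℕ) = d (s + k) * Q + (b * m ^ (k + 1) % Q : ℕ) := by
      field_simp at e
      linarith
    exact_mod_cast this
  rw [e2, add_comm, Nat.add_mul_div_right _ _ (by omega),
    Nat.div_eq_of_lt (Nat.mod_lt _ (by omega)), zero_add]
  exact hdD _

/-! ### Leading digits in a residue class -/

/-- The leading base-`m` digits of a full residue class modulo `Q / M` take at least `min m M`
values. -/
theorem exists_digit_notMem {m Q L M : ℕ} (hL : 0 < L) (hQ : Q = L * M) {D : Finset ℕ}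
    (hDm : D.card < m) (hDM : D.card < M) {r : ℕ → ℕ} (hr : ∀ i, r i < Q) {c : ℕ}
    (hrc : ∀ i, r i % L = c) (hinj : Set.InjOn r (Finset.range M)) :
    ∃ i, m * r i / Q ∉ D := by
  by_contra! hmem
  have hQ0 : 0 < Q := by rw [hQ]; exact Nat.mul_pos hL (by omega)
  rcases le_total M m with hMm | hmM
  · have : M ≤ D.card := by
      rw [← Finset.card_range M]
      refine Finset.card_le_card_of_injOn (fun i => m * r i / Q) (fun i _ => hmem i) ?_
      -- Points of the class differ by at least `L = Q / M ≥ Q / m`, so their digits differ.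
      have key : ∀ i j, r i < r j → m * r i / Q < m * r j / Q := by
        intro i j hij
        have h1 : r i + L ≤ r j := by
          have h2 : r i ≡ r j [MOD L] := (hrc i).trans (hrc j).symm
          have h3 := Nat.le_of_dvd (by omega) ((Nat.modEq_iff_dvd' hij.le).mp h2)
          omega
        have h4 : m * r i + Q ≤ m * r j := by
          calc m * r i + Q ≤ m * r i + m * L := by rw [hQ, mul_comm L M]; gcongr
            _ = m * (r i + L) := by ring
            _ ≤ _ := by gcongr
        calc m * r i / Q < m * r i / Q + 1 := Nat.lt_succ_self _
          _ = (m * r i + Q) / Q := (Nat.add_div_right _ hQ0).symm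
          _ ≤ _ := Nat.div_le_div_right h4
      intro i hi j hj hij
      refine hinj hi hj ?_
      rcases lt_trichotomy (r i) (r j) with h | h | h
      · exact absurd hij (key i j h).ne
      · exact h
      · exact absurd hij (key j i h).ne'
    omega
  -- Now the spacing `L` is at most `Q / m`, so the class meets the interval of every digit, in
  -- particular of some `e ∉ D`.
  · obtain ⟨e, he, heD⟩ : ∃ e ∈ Finset.range m, e ∉ D := by
      by_contra! h
      have := Finset.card_le_card (show Finset.range m ⊆ D from h)
      simp at this
      omega
    have hem : e < m := Finset.mem_range.mp he
    have hc : c < L := by rw [← hrc 0]; exact Nat.mod_lt _ hL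
    have himg : (Finset.range M).image r = (Finset.range M).image fun j => c + L * j := by
      apply Finset.eq_of_subset_of_card_le
      · intro y hy
        obtain ⟨i, -, rfl⟩ := Finset.mem_image.mp hy
        refine Finset.mem_image.mpr ⟨r i / L, ?_, ?_⟩
        · exact Finset.mem_range.mpr (Nat.div_lt_of_lt_mul (hQ ▸ hr i))
        · rw [← hrc i]; exact Nat.mod_add_div _ _
      · rw [Finset.card_image_of_injOn hinj]
        exact Finset.card_image_le
    have hex : ∃ j, e * Q ≤ m * (c + L * j) :=
      ⟨e * Q, by
        calc e * Q ≤ 1 * (0 + 1 * (e * Q)) := by simp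
          _ ≤ m * (c + L * (e * Q)) := by gcongr <;> omega⟩
    classical
    have hmin := fun j => Nat.find_min hex (m := j)
    have hspec := Nat.find_spec hex
    generalize Nat.find hex = j at hmin hspec
    have hmL : m * L ≤ Q := by rw [hQ, mul_comm]; gcongr
    have hup : m * (c + L * j) < (e + 1) * Q := by
      rcases Nat.eq_zero_or_pos j with rfl | hj
      · calc m * (c + L * 0) < m * L := by
              rw [mul_zero, add_zero]; exact Nat.mul_lt_mul_of_pos_left hc (by omega)
          _ ≤ 1 * Q := by omega
          _ ≤ _ := by gcongr; omega
      · have := hmin (j - 1) (by omega)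
        push Not at this
        obtain ⟨j, rfl⟩ : ∃ i, j = i + 1 := ⟨j - 1, by omega⟩
        simp only [Nat.add_sub_cancel] at this
        nlinarith
    have hjM : j < M := by
      by_contra! h
      have h1 : Q ≤ c + L * j := by
        rw [hQ]; exact (Nat.mul_le_mul_left L h).trans (Nat.le_add_left _ _)
      have h2 : (e + 1) * Q ≤ m * (c + L * j) := Nat.mul_le_mul hem h1
      omega
    have : c + L * j ∈ (Finset.range M).image r := by
      rw [himg]; exact Finset.mem_image_of_mem _ (Finset.mem_range.mpr hjM)
    obtain ⟨i, -, hi⟩ := Finset.mem_image.mp this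
    apply heD
    have := hmem i
    rwa [hi, Nat.div_eq_of_lt_le hspec hup] at this

/-! ### Valuations and exponents of powers -/

/-- The exponent to which `p` divides `m ^ d - 1` (`p` odd) or `m ^ 2 - 1` (`p = 2`). -/
noncomputable def baseVal (m p : ℕ) : ℕ :=
  if p = 2 then padicValNat 2 (m ^ 2 - 1) else padicValNat p (m ^ orderOf (m : ZMod p) - 1)

/-- Lifting the exponent, with `d` the order of `m` modulo `p`, or `d = 2` when `p = 2`. -/
theorem exists_padicValNat_pow_sub_one {m p : ℕ} (hm : 2 ≤ m) (hp : p.Prime) (hpm : ¬ p ∣ m) :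
    ∃ d, ∀ k, k ≠ 0 → padicValNat p (m ^ (d * k) - 1) = baseVal m p + padicValNat p k := by
  have : Fact p.Prime := ⟨hp⟩
  unfold baseVal
  split_ifs with h2
  · subst h2
    refine ⟨2, fun k hk => ?_⟩
    have h := padicValNat.pow_two_sub_pow (x := m) (y := 1) (by omega)
      (by omega) hpm (n := 2 * k) (by omega) (by simp)
    have h' : padicValNat 2 (m ^ 2 - 1) = padicValNat 2 (m + 1) + padicValNat 2 (m - 1) := by
      rw [← padicValNat.mul (by omega) (by omega), ← Nat.sq_sub_sq, one_pow]
    rw [padicValNat.mul (by norm_num) hk, one_pow, padicValNat.self (by norm_num)] at h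
    omega
  · refine ⟨orderOf (m : ZMod p), fun k hk => ?_⟩
    have hm0 : (m : ZMod p) ≠ 0 := by rwa [Ne, ZMod.natCast_eq_zero_iff]
    have hd : 0 < orderOf (m : ZMod p) :=
      orderOf_pos_iff.mpr (isOfFinOrder_iff_pow_eq_one.mpr
        ⟨p - 1, Nat.sub_pos_of_lt hp.one_lt, ZMod.pow_card_sub_one_eq_one hm0⟩)
    have hdvd : p ∣ m ^ orderOf (m : ZMod p) - 1 := by
      rw [← ZMod.natCast_eq_zero_iff, Nat.cast_sub (Nat.one_le_pow _ _ (by omega))]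
      push_cast
      rw [pow_orderOf_eq_one, sub_self]
    have h := padicValNat.pow_sub_pow (p := p) (x := m ^ orderOf (m : ZMod p)) (y := 1)
      (hp.odd_of_ne_two h2) (Nat.one_lt_pow hd.ne' (by omega)) hdvd
      (fun h => hpm (hp.dvd_of_dvd_pow h)) hk
    rw [one_pow, ← pow_mul] at h
    exact h

theorem le_largestPrimeFactor {n q : ℕ} (hn : n ≠ 0) (hq : q.Prime) (hqn : q ∣ n) :
    q ≤ largestPrimeFactor n := by
  unfold largestPrimeFactor
  split_ifs with h
  · subst h
    exact absurd (Nat.dvd_one.mp hqn) hq.ne_one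
  · exact Finset.le_sup (f := id) (Nat.mem_primeFactors.mpr ⟨hq, hqn, hn⟩)

/-- If all prime factors of `R` are at most `B + 1` and differ from `p`, then some exponent `k`
with `ν_p(k) = log_p B` annihilates the units modulo `R`. -/
theorem exists_pow_modEq_one {R p B : ℕ} (hp : p.Prime) (hR : R ≠ 0) (hpR : ¬ p ∣ R)
    (hB : ∀ q, q.Prime → q ∣ R → q - 1 ≤ B) :
    ∃ k ≠ 0, padicValNat p k = Nat.log p B ∧ ∀ x : ℕ, x.Coprime R → R ∣ x ^ k - 1 := by
  have : Fact p.Prime := ⟨hp⟩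
  have hφ : R.totient ≠ 0 := (Nat.totient_pos.mpr (Nat.pos_of_ne_zero hR)).ne'
  have hc0 : ordCompl[p] R.totient ≠ 0 := (Nat.ordCompl_pos p hφ).ne'
  refine ⟨p ^ Nat.log p B * ordCompl[p] R.totient, mul_ne_zero (pow_ne_zero _ hp.ne_zero) hc0,
    ?_, fun x hx => ?_⟩
  · rw [padicValNat.mul (pow_ne_zero _ hp.ne_zero) hc0, padicValNat.prime_pow,
      padicValNat.eq_zero_of_not_dvd (Nat.not_dvd_ordCompl hp hφ), add_zero]
  · rw [Nat.dvd_iff_prime_pow_dvd_dvd]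
    intro q b hq hqb
    rcases Nat.eq_zero_or_pos b with rfl | hb
    · simp
    have hqR : q ∣ R := (dvd_pow_self q hb.ne').trans hqb
    have hqp : q ≠ p := by rintro rfl; exact hpR hqR
    -- Treating prime powers separately bounds the `p`-part by a maximum over `q` rather than a
    -- product; since `q ≠ p`, it is the `p`-part of `q - 1 ≤ B`.
    have h1 : (q ^ b).totient ∣ p ^ Nat.log p B * ordCompl[p] R.totient := by
      rw [← Nat.ordProj_mul_ordCompl_eq_self (q ^ b).totient p]
      refine mul_dvd_mul (pow_dvd_pow p ?_)
        (Nat.ordCompl_dvd_ordCompl_of_dvd (Nat.totient_dvd_of_dvd hqb) p)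
      have hq1 : q - 1 ≠ 0 := by have := hq.two_le; omega
      rw [Nat.totient_prime_pow hq hb, Nat.factorization_def _ hp,
        padicValNat.mul (pow_ne_zero _ hq.ne_zero) hq1, padicValNat.eq_zero_of_not_dvd
          (fun h => hqp ((Nat.prime_dvd_prime_iff_eq hp hq).mp (hp.dvd_of_dvd_pow h)).symm),
        zero_add]
      exact (padicValNat_le_nat_log _).trans (Nat.log_mono_right (hB q hq hqR))
    have hxq : x.Coprime (q ^ b) := hx.coprime_dvd_right hqb
    obtain ⟨w, hw⟩ := h1
    rw [hw, pow_mul]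
    have h2 := (Nat.ModEq.pow_totient hxq).pow w
    rw [one_pow] at h2
    rcases Nat.eq_zero_or_pos ((x ^ (q ^ b).totient) ^ w) with h0 | h0
    · simp [h0]
    · exact (Nat.modEq_iff_dvd' h0).mp h2.symm

/-! ### The orbit argument -/

/-- A number whose denominator `Q` is divisible by a high power of `p` is not in `K_{m,D}`. -/
theorem notMem_missingDigitSet {m : ℕ} (hm : 2 ≤ m) {D : Finset ℕ} (hD : ∀ d ∈ D, d < m)
    (hDm : D.card < m) {p : ℕ} (hp : p.Prime) {b Q s : ℕ} (hQ : 1 < Q) (hQm : Q.Coprime m)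
    (hb : b.Coprime Q)
    (hlt : p ^ (baseVal m p + Nat.log p (largestPrimeFactor Q - 1)) * D.card
      < p ^ padicValNat p Q) (hD0 : D.card ≠ 0)
    {x : ℝ} (hs : (m : ℝ) ^ s * x = b / Q) : x ∉ missingDigitSet m D := by
  intro hx
  have : Fact p.Prime := ⟨hp⟩
  have hQ0 : Q ≠ 0 := by omega
  set w := baseVal m p + Nat.log p (largestPrimeFactor Q - 1) with hw
  have hwν : w < padicValNat p Q := by
    refine (Nat.pow_lt_pow_iff_right hp.one_lt).mp (lt_of_le_of_lt ?_ hlt)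
    exact Nat.le_mul_of_pos_right _ (Nat.pos_of_ne_zero hD0)
  have hpQ : p ∣ Q := dvd_of_one_le_padicValNat (by omega)
  have hpm : ¬ p ∣ m := fun h => hp.ne_one (Nat.eq_one_of_dvd_coprimes hQm hpQ h)
  obtain ⟨R, hR⟩ : p ^ padicValNat p Q ∣ Q := pow_padicValNat_dvd
  have hR0 : R ≠ 0 := by rintro rfl; simp at hR; omega
  have hpR : ¬ p ∣ R := by
    rintro ⟨R', rfl⟩
    apply pow_succ_padicValNat_not_dvd (p := p) hQ0
    refine ⟨R', ?_⟩
    rw [pow_succ]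
    linarith
  have hRQ : R ∣ Q := ⟨_, hR.trans (mul_comm _ _)⟩
  obtain ⟨d, hd⟩ := exists_padicValNat_pow_sub_one hm hp hpm
  obtain ⟨k, hk0, hkv, hk⟩ := exists_pow_modEq_one (B := largestPrimeFactor Q - 1) hp hR0 hpR
    (fun q hq hqR => Nat.sub_le_sub_right
      (le_largestPrimeFactor hQ0 hq (hqR.trans hRQ)) 1)
  have hval : ∀ i, i ≠ 0 → padicValNat p (m ^ (d * k * i) - 1) = w + padicValNat p i := by
    intro i hi
    rw [mul_assoc, hd _ (mul_ne_zero hk0 hi), padicValNat.mul hk0 hi, hkv, hw, add_assoc]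
  have hcop : ∀ i, (m ^ i).Coprime Q := fun i => hQm.symm.pow_left i
  have hone : ∀ i, 1 ≤ m ^ i := fun i => Nat.one_le_pow _ _ (by omega)
  have hmod : ∀ i, p ^ w * R ∣ m ^ (d * k * i) - 1 := by
    intro i
    rcases Nat.eq_zero_or_pos i with rfl | hi
    · simp
    refine Nat.Coprime.mul_dvd_of_dvd_of_dvd ((hp.coprime_iff_not_dvd.mpr hpR).pow_left w) ?_ ?_
    · exact (pow_dvd_pow p (by rw [hval i hi.ne']; omega)).trans pow_padicValNat_dvd
    · have := hk (m ^ (d * i)) ((hcop _).coprime_dvd_right hRQ)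
      rwa [← pow_mul, show d * i * k = d * k * i by ring] at this
  suffices h : ∃ i, m * (b * m ^ (d * k * i) % Q) / Q ∉ D by
    obtain ⟨i, hi⟩ := h
    exact hi (digit_mem_of_mem hm hD hx hQ hQm hb hs (d * k * i))
  refine exists_digit_notMem (m := m) (Q := Q) (L := p ^ w * R)
    (M := p ^ (padicValNat p Q - w)) (D := D) (r := fun i => b * m ^ (d * k * i) % Q)
    (c := b % (p ^ w * R)) (Nat.mul_pos (pow_pos hp.pos _) (Nat.pos_of_ne_zero hR0)) ?_ hDm ?_
    (fun i => Nat.mod_lt _ (by omega)) ?_ ?_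
  · conv_lhs => rw [hR, ← Nat.add_sub_cancel' hwν.le, pow_add]
    ring
  · rw [← Nat.add_sub_cancel' hwν.le, pow_add p w (_ - w)] at hlt
    exact Nat.lt_of_mul_lt_mul_left hlt
  · intro i
    have hLQ : p ^ w * R ∣ Q := by
      conv_rhs => rw [hR]
      exact mul_dvd_mul_right (pow_dvd_pow p hwν.le) R
    rw [Nat.mod_mod_of_dvd _ hLQ]
    have h := ((Nat.modEq_iff_dvd' (hone _)).mpr (hmod i)).symm.mul_left b
    rwa [mul_one] at h
  · have key : ∀ i j, i < j → j < p ^ (padicValNat p Q - w) →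
        b * m ^ (d * k * i) % Q ≠ b * m ^ (d * k * j) % Q := by
      intro i j hij hj h
      have h1 : m ^ (d * k * i) ≡ m ^ (d * k * j) [MOD Q] :=
        Nat.ModEq.cancel_left_of_coprime hb.symm h
      obtain ⟨l, rfl⟩ := Nat.exists_eq_add_of_lt hij
      have h2 : m ^ (d * k * i) * 1 ≡ m ^ (d * k * i) * m ^ (d * k * (l + 1)) [MOD Q] := by
        rw [mul_one, ← pow_add, ← mul_add, ← add_assoc]; exact h1
      have h3 := Nat.ModEq.cancel_left_of_coprime (hcop _).symm h2
      have h4 := (Nat.modEq_iff_dvd' (hone _)).mp h3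
      -- Otherwise both `l + 1` and `p * (l + 1)` give `padicValNat p 0` in `hval`, though their
      -- valuations differ by one.
      have h5 : m ^ (d * k * (l + 1)) - 1 ≠ 0 := by
        intro h0
        have := hval (l + 1) (by omega)
        have hdk := hval (p * (l + 1)) (mul_ne_zero hp.ne_zero (by omega))
        have h6 : m ^ (d * k * (p * (l + 1))) - 1 = 0 := by
          rw [show d * k * (p * (l + 1)) = d * k * (l + 1) * p by ring, pow_mul,
            le_antisymm (by omega) (hone (d * k * (l + 1))), one_pow, Nat.sub_self]
        rw [h6, padicValNat.mul hp.ne_zero (by omega), padicValNat.self hp.one_lt] at hdk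
        rw [h0] at this
        omega
      have h6 := (padicValNat_dvd_iff_le (p := p) h5).mp (pow_padicValNat_dvd.trans h4)
      rw [hval _ (by omega)] at h6
      have h7 : p ^ (padicValNat p Q - w) ∣ l + 1 :=
        (pow_dvd_pow p (by omega)).trans pow_padicValNat_dvd
      have := Nat.le_of_dvd (by omega) h7
      omega
    intro i hi j hj hij
    rcases lt_trichotomy i j with h | h | h
    · exact absurd hij (key i j h (by simpa using hj))
    · exact h
    · exact absurd hij.symm (key j i h (by simpa using hi))

/-! ### From logarithms to the integer inequality -/

theorem two_mul_card_le_korobovConst {m : ℕ} {D : Finset ℕ} (hD : 1 ≤ D.card)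
    (hDm : D.card < m) : 2 * (D.card : ℝ) ≤ korobovConst m D := by
  have h1 : (1 : ℝ) ≤ D.card := by exact_mod_cast hD
  have h2 : (D.card : ℝ) + 1 ≤ m := by exact_mod_cast hDm
  have h3 : (0 : ℝ) < m - D.card := by linarith
  unfold korobovConst
  rw [mul_assoc]
  refine mul_le_mul_of_nonneg_left ?_ (by norm_num)
  rw [mul_min_of_nonneg _ _ (by linarith : (0 : ℝ) ≤ m - 1)]
  refine le_min (by linarith) ?_
  rw [← mul_div_assoc, le_div_iff₀ h3, mul_comm]
  exact mul_le_mul_of_nonneg_right (by linarith) (by linarith)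

/-- The factor `2` pays for the `-1` in `overhead` at `p = 2`; it is recovered from `2 * #D ≤
c_{m,D}`. -/
theorem pow_baseVal_le {m p : ℕ} (hp : p.Prime) :
    (p : ℝ) ^ baseVal m p ≤ 2 * (p : ℝ) ^ (overhead m p : ℝ) := by
  have hp0 : (0 : ℝ) < p := by exact_mod_cast hp.pos
  rw [Real.rpow_intCast]
  unfold baseVal overhead
  split_ifs with h
  · subst h
    rw [zpow_sub_one₀ (by norm_num), zpow_natCast]
    apply le_of_eq
    push_cast
    ring
  · rw [zpow_natCast]
    have : 0 < (p : ℝ) ^ padicValNat p (m ^ orderOf (m : ZMod p) - 1) := by positivity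
    linarith

theorem pow_mul_card_lt_of_cut {m : ℕ} {D : Finset ℕ} (hD : 1 ≤ D.card) (hDm : D.card < m)
    {p Q : ℕ} (hp : p.Prime) {α β : ℝ} (hα : α ≤ padicValNat p Q)
    (hβ : (largestPrimeFactor Q : ℝ) ≤ β) (hβ2 : 2 ≤ β)
    (hcut : (overhead m p : ℝ) + Real.logb p (β - 1) + Real.logb p (korobovConst m D) < α) :
    p ^ (baseVal m p + Nat.log p (largestPrimeFactor Q - 1)) * D.card < p ^ padicValNat p Q := by
  have hp0 : (0 : ℝ) < p := by exact_mod_cast hp.pos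
  have hp1 : (1 : ℝ) < p := by exact_mod_cast hp.one_lt
  have hK := two_mul_card_le_korobovConst hD hDm
  have hD1 : (1 : ℝ) ≤ D.card := by exact_mod_cast hD
  have h1 : (p : ℝ) ^ (overhead m p : ℝ) * (β - 1) * korobovConst m D
      < (p : ℝ) ^ padicValNat p Q := by
    have := Real.rpow_lt_rpow_of_exponent_lt hp1 (hcut.trans_le hα)
    rwa [Real.rpow_add hp0, Real.rpow_add hp0, Real.rpow_logb hp0 hp1.ne' (by linarith),
      Real.rpow_logb hp0 hp1.ne' (by linarith), Real.rpow_natCast] at this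
  have h2 : (p : ℝ) ^ Nat.log p (largestPrimeFactor Q - 1) ≤ β - 1 := by
    -- `Nat.log p 0 = 0` makes the power `1`, so `β ≥ 2` is needed here.
    rcases Nat.eq_zero_or_pos (largestPrimeFactor Q - 1) with h | h
    · rw [h, Nat.log_zero_right, pow_zero]; linarith
    · have h3 : p ^ Nat.log p (largestPrimeFactor Q - 1) + 1 ≤ largestPrimeFactor Q := by
        have := Nat.pow_log_le_self p h.ne'
        omega
      have h4 : (p : ℝ) ^ Nat.log p (largestPrimeFactor Q - 1) + 1 ≤ largestPrimeFactor Q := by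
        exact_mod_cast h3
      linarith
  have h5 : (p : ℝ) ^ (baseVal m p + Nat.log p (largestPrimeFactor Q - 1)) * D.card
      < (p : ℝ) ^ padicValNat p Q := by
    calc (p : ℝ) ^ (baseVal m p + Nat.log p (largestPrimeFactor Q - 1)) * D.card
        = (p : ℝ) ^ baseVal m p * (p : ℝ) ^ Nat.log p (largestPrimeFactor Q - 1) * D.card := by
          rw [pow_add]
      _ ≤ 2 * (p : ℝ) ^ (overhead m p : ℝ) * (β - 1) * D.card := by
          gcongr
          exact pow_baseVal_le hp
      _ = (p : ℝ) ^ (overhead m p : ℝ) * (β - 1) * (2 * D.card) := by ring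
      _ ≤ (p : ℝ) ^ (overhead m p : ℝ) * (β - 1) * korobovConst m D :=
          mul_le_mul_of_nonneg_left hK (mul_nonneg (by positivity) (by linarith))
      _ < _ := h1
  exact_mod_cast h5

end MissingDigit

theorem mainTheorem3
    (m : ℕ) (hm : 3 ≤ m)
    (D : Finset ℕ) (hD : ∀ d ∈ D, d < m) (hD_gt : 1 < D.card) (hD_lt : D.card < m)
    (a : ℕ → ℕ) (ha : ∀ n, 1 ≤ n → 1 ≤ a n)
    (p₀ : ℕ) (hp₀ : p₀.Prime) (hp₀m : ¬ p₀ ∣ m)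
    (α β : ℕ → ℝ) (N : ℕ) (hN : 1 ≤ N)
    (hα : ∀ n, N ≤ n → α n ≤ (padicValNat p₀ (MissingDigit.coprimePart (a n) m) : ℝ))
    (hβ : ∀ n, N ≤ n →
      (MissingDigit.largestPrimeFactor (MissingDigit.coprimePart (a n) m) : ℝ) ≤ β n)
    (hβ_two : ∀ n, N ≤ n → 2 ≤ β n)
    (n₀ : ℕ) (hn₀ : N ≤ n₀)
    (hcut : ∀ n, n₀ ≤ n →
      (MissingDigit.overhead m p₀ : ℝ) + Real.logb (p₀ : ℝ) (β n - 1)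
        + Real.logb (p₀ : ℝ) (MissingDigit.korobovConst m D) < α n) :
    (∀ n, n₀ ≤ n → 1 / (a n : ℝ) ∉ MissingDigit.missingDigitSet m D) ∧
      ({x : ℝ | ∃ n : ℕ, 1 ≤ n ∧ x = 1 / (a n : ℝ)} ∩
        MissingDigit.missingDigitSet m D).Finite := by
  have main : ∀ n, n₀ ≤ n → 1 / (a n : ℝ) ∉ MissingDigit.missingDigitSet m D := by
    intro n hn
    have han : a n ≠ 0 := Nat.one_le_iff_ne_zero.mp (ha n (by omega))
    have hlt := MissingDigit.pow_mul_card_lt_of_cut hD_gt.le hD_lt hp₀ (hα n (by omega))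
      (hβ n (by omega)) (hβ_two n (by omega)) (hcut n hn)
    have hQm := MissingDigit.coprime_coprimePart han (by omega : m ≠ 0)
    have hAQ : MissingDigit.mPart (a n) m * MissingDigit.coprimePart (a n) m = a n :=
      Nat.mul_div_cancel' (MissingDigit.mPart_dvd (a n) m)
    set Q := MissingDigit.coprimePart (a n) m
    have hQ0 : Q ≠ 0 := by rintro h; simp [h] at hAQ; omega
    -- If `Q = 1`, then `ν = 0` and `hlt` would put a positive integer below `1`.
    have hQ : 1 < Q := by
      rcases Nat.lt_or_ge 1 Q with h | h
      · exact h
      · have hQ1 : Q = 1 := by omega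
        rw [hQ1, padicValNat_one_right, pow_zero, Nat.lt_one_iff] at hlt
        exact absurd hlt (mul_ne_zero (pow_ne_zero _ hp₀.ne_zero) (by omega))
    obtain ⟨b, hb⟩ := MissingDigit.mPart_dvd_pow (a n) m
    have hbQ : b.Coprime Q :=
      (hQm.symm.pow_left (a n)).coprime_dvd_left ⟨_, hb.trans (mul_comm _ _)⟩
    refine MissingDigit.notMem_missingDigitSet (by omega) hD hD_lt hp₀ hQ hQm hbQ hlt (by omega)
      (s := a n) ?_
    have hb' : (m : ℝ) ^ a n = MissingDigit.mPart (a n) m * b := by exact_mod_cast hb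
    have hAQ' : (MissingDigit.mPart (a n) m : ℝ) * Q = a n := by exact_mod_cast hAQ
    have hA0 : (MissingDigit.mPart (a n) m : ℝ) ≠ 0 := by
      intro h
      rw [h, zero_mul] at hAQ'
      exact han (by exact_mod_cast hAQ'.symm)
    have hQ0' : (Q : ℝ) ≠ 0 := by exact_mod_cast hQ0
    rw [hb', ← hAQ']
    field_simp
  refine ⟨main, ((Set.finite_lt_nat n₀).image fun n => 1 / (a n : ℝ)).subset ?_⟩
  rintro x ⟨⟨n, -, rfl⟩, hx⟩
  exact ⟨n, not_le.mp fun h => main n h hx, rfl⟩
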